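/- Let $\mathcal C$ be a finitely complete category with a stable factorization system $(\mathcal E,\mathcal M)$: $\mathcal E$ and $\mathcal M$ are classes of morphisms closed under composition with isomorphisms, every morphism of $\mathcal C$ factors as $m e$ with $e\in\mathcal E$, $m\in\mathcal M$, for every commutative square $m u = w e$ with $e\in\mathcal E$, $m\in\mathcal M$ there is a unique $d$ with $de=u$, $md=w$, and $\mathcal E$ is stable under pullback. (No epi- or mono-conditions are imposed.) A *stable system* is a class of morphisms of $\mathcal C$ that contains the isomorphisms, is closed under composition and is stable under pullback. For $m:Y\to W$ in $\mathcal M$ and morphisms $f:X\to Y$, $s:Z\to Y$, the *conjugate* of $m$ along $f$ and $s$ is the canonical morphism $X\times_Y Z\to X\times_W Z$ from the pullback of $f,s$ to the pullback of $mf,ms$. Let $\mathcal M^*$ be the closure under pullbacks of the class of all conjugates of morphisms of $\mathcal M$, and let $\mathcal E_\bullet$ be the least stable system containing $\mathcal E$ and $\mathcal M^*$. For a stable system $\mathcal F$, let $\sim_{\mathcal F}$ be the least equivalence relation on spans $A\xleftarrow{f}D\xrightarrow{g}B$ such that $(f,g)\sim_{\mathcal F}(\tilde f,\tilde g)$ whenever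 $f=\tilde f x$ and $g=\tilde g x$ for some $x\in\mathcal F$. The category $\mathsf{Span}_{\mathcal F}(\mathcal C)$ has the objects of $\mathcal C$; its morphisms $A\to B$ are the classes $[f,g]_{\mathcal F}$ of spans, composed by pullback. Put $[f,g]_{\mathcal F}^\circ=[g,f]_{\mathcal F}$, and let $[f,g]_{\mathcal F}\wedge[p,q]_{\mathcal F}=[\pi_1d,\pi_2d]_{\mathcal F}$, where $\pi_1,\pi_2$ are the projections of $A\times B$ and $d$ is the diagonal of the pullback of $\langle f,g\rangle$ and $\langle p,q\rangle$ over $A\times B$. An *allegory* is a category $\mathcal A$ whose hom-sets are posets with binary infima $\wedge$, with monotone composition, and with an involution $(-)^\circ:\mathcal A^{\mathrm{op}}\to\mathcal A$ which is the identity on objects and preserves infima, such that $(s r)\wedge t\le s\,(r\wedge s^\circ t)$ for all $r:A\to B$, $s:B\to C$, $t:A\to C$. In an allegory, $r$ is a *map* if $1\le r^\circ r$ and $r r^\circ\le 1$; a pair $(u,v)$ of maps with common domain *tabulates* $r$ if $r=v u^\circ$ and $u^\circ u\wedge v^\circ v=1$; the allegory is *tabular* if every morphism is tabulated by some pair of maps.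 An object $T$ is a *unit* if $1_T$ is the maximum of $\mathcal A(T,T)$ and for every object $A$ there is $r:A\to T$ with $1_A\le r^\circ r$; the allegory is *unitary* if it has a unit. **Theorem.** With the operations $(-)^\circ$ and $\wedge$ above and the order given by $r\le s\iff r\wedge s=r$, the category $\mathsf{Span}_{\mathcal E_\bullet}(\mathcal C)$ is a unitary tabular allegory. Any terminal object of $\mathcal C$ is a unit in it. For every span $(f,g):A\to B$ and every factorization $\langle f,g\rangle=me$ with $e\in\mathcal E$, $m\in\mathcal M$, the pair $([1,\pi_1m]_{\mathcal E_\bullet},[1,\pi_2m]_{\mathcal E_\bullet})$ tabulates $[f,g]_{\mathcal E_\bullet}$; in particular $$[f,g]_{\mathcal E_\bullet}=[1,\pi_2m]_{\mathcal E_\bullet}\circ[1,\pi_1m]_{\mathcal E_\bullet}^\circ .$$ -/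

import Mathlib

open CategoryTheory CategoryTheory.Limits

universe v u

namespace SpanAllegory

/-! ### Allegories -/

/-- An allegory: a poset-enriched category with an involution and binary meets in each hom-set,
preserved by the involution, which satisfies Freyd's modular law.
Composition is written in diagrammatic order: `r ≫ s` is `s · r`. -/
class Allegory (A : Type u) [Category.{v} A] where
  /-- each hom-set is a poset with binary infima -/
  homInf (X Y : A) : SemilatticeInf (X ⟶ Y)
  comp_mono {X Y Z : A} {r r' : X ⟶ Y} {s s' : Y ⟶ Z} :
    r ≤ r' → s ≤ s' → r ≫ s ≤ r' ≫ s'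
  /-- the involution `r ↦ r°` -/
  conv {X Y : A} (r : X ⟶ Y) : Y ⟶ X
  conv_conv {X Y : A} (r : X ⟶ Y) : conv (conv r) = r
  conv_id (X : A) : conv (𝟙 X) = 𝟙 X
  conv_comp {X Y Z : A} (r : X ⟶ Y) (s : Y ⟶ Z) : conv (r ≫ s) = conv s ≫ conv r
  conv_inf {X Y : A} (r s : X ⟶ Y) : conv (r ⊓ s) = conv r ⊓ conv s
  modular {X Y Z : A} (r : X ⟶ Y) (s : Y ⟶ Z) (t : X ⟶ Z) :
    (r ≫ s) ⊓ t ≤ (r ⊓ (t ≫ conv s)) ≫ s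

attribute [reducible, instance] Allegory.homInf

namespace Allegory

variable {A : Type u} [Category.{v} A] [Allegory A]

/-- `r` is a map: `1 ≤ r° · r` and `r · r° ≤ 1`. -/
def IsMap {X Y : A} (r : X ⟶ Y) : Prop :=
  𝟙 X ≤ r ≫ conv r ∧ conv r ≫ r ≤ 𝟙 Y

/-- The pair of maps `(f, g)` tabulates `r`: `r = g · f°` and `(f° · f) ∧ (g° · g) = 1`. -/
def Tabulates {X Y Z : A} (f : Z ⟶ X) (g : Z ⟶ Y) (r : X ⟶ Y) : Prop :=
  IsMap f ∧ IsMap g ∧ r = conv f ≫ g ∧ (f ≫ conv f) ⊓ (g ≫ conv g) = 𝟙 Z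

variable (A) in
/-- Every morphism is tabulated by some pair of maps. -/
def IsTabular : Prop :=
  ∀ (X Y : A) (r : X ⟶ Y), ∃ (Z : A) (f : Z ⟶ X) (g : Z ⟶ Y), Tabulates f g r

/-- `1_T` is the maximum of the endomorphisms of `T`. -/
def IsPartialUnit (T : A) : Prop :=
  ∀ r : T ⟶ T, r ≤ 𝟙 T

/-- `T` is a unit: a partial unit such that every `X` has some `r : X ⟶ T` with `1 ≤ r° · r`. -/
def IsUnitObject (T : A) : Prop :=
  IsPartialUnit T ∧ ∀ X : A, ∃ r : X ⟶ T, 𝟙 X ≤ r ≫ conv r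

variable (A) in
/-- The allegory has a unit. -/
def IsUnitary : Prop := ∃ T : A, IsUnitObject T

end Allegory

/-! ### Stable systems and stable factorization systems -/

section Systems

variable {C : Type u} [Category.{v} C]

/-- A stable system: a class of morphisms which contains the isomorphisms, is closed under
composition and is stable under pullback. (It contains the isomorphisms because it contains the
identities and pullbacks are only determined up to isomorphism, see `IsStableSystem.of_isIso`.) -/
class IsStableSystem (E : MorphismProperty C) : Prop
    extends E.IsMultiplicative, E.IsStableUnderBaseChange

theorem IsStableSystem.of_isIso (E : MorphismProperty C) [IsStableSystem E] {X Y : C}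
    (f : X ⟶ Y) [IsIso f] : E f :=
  MorphismProperty.of_isIso E f

/-- `(E, M)` is an (orthogonal) factorization system which is stable, i.e. `E` is stable under
pullback. Neither epi- nor mono-conditions are imposed. -/
structure IsStableFactorizationSystem (E M : MorphismProperty C) : Prop where
  left_respectsIso : E.RespectsIso
  right_respectsIso : M.RespectsIso
  hasFactorization : MorphismProperty.HasFactorization E M
  existsUnique_diagonal {X Y Z W : C} {u : X ⟶ Z} {e : X ⟶ Y} {m : Z ⟶ W} {w : Y ⟶ W} :
    E e → M m → u ≫ m = e ≫ w → ∃! d : Y ⟶ Z, e ≫ d = u ∧ d ≫ m = w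
  left_stable : E.IsStableUnderBaseChange

/-- The class of all conjugates of morphisms of `M`: for `m : Y ⟶ W` in `M` and `f : X ⟶ Y`,
`s : Z ⟶ Y`, the conjugate of `m` along `f` and `s` is the canonical comparison `c` from the
pullback `P` of `s` and `f` to the pullback `Q` of `s ≫ m` and `f ≫ m`. -/
def conjugates (M : MorphismProperty C) : MorphismProperty C := fun P Q c =>
  ∃ (X Y Z W : C) (f : X ⟶ Y) (s : Z ⟶ Y) (m : Y ⟶ W)
    (f' : P ⟶ Z) (s' : P ⟶ X) (g' : Q ⟶ Z) (t' : Q ⟶ X),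
    M m ∧ IsPullback f' s' s f ∧ IsPullback g' t' (s ≫ m) (f ≫ m) ∧
      c ≫ g' = f' ∧ c ≫ t' = s'

/-- The class `M*`: the closure under pullbacks of the class of all conjugates. -/
def starClass (M : MorphismProperty C) : MorphismProperty C := (conjugates M).pullbacks

/-- The class `E•`: the least stable system containing both `E` and `M*`
(see `bullet_isLeast`). -/
def bullet (E M : MorphismProperty C) : MorphismProperty C := fun _ _ f =>
  ∀ F : MorphismProperty C, IsStableSystem F → E ≤ F → starClass M ≤ F → F f

instance (E M : MorphismProperty C) : IsStableSystem (bullet E M) where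
  id_mem X := fun F _ _ _ => F.id_mem X
  comp_mem f g hf hg := fun F h hE hM => F.comp_mem f g (hf F h hE hM) (hg F h hE hM)
  of_isPullback sq hg := fun F h hE hM => F.of_isPullback sq (hg F h hE hM)

theorem bullet_isLeast (E M : MorphismProperty C) :
    IsLeast {F : MorphismProperty C | IsStableSystem F ∧ E ≤ F ∧ starClass M ≤ F} (bullet E M) :=
  ⟨⟨inferInstance, fun _ _ _ h _ _ hE _ => hE _ h, fun _ _ _ h _ _ _ hM => hM _ h⟩,
    fun F hF _ _ _ h => h F hF.1 hF.2.1 hF.2.2⟩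

end Systems

/-! ### Spans -/

section Spans

variable {C : Type u} [Category.{v} C]

/-- Spans in `C` from `X` to `Y`, without restriction on the legs. -/
abbrev Spn (X Y : C) := Span (⊤ : MorphismProperty C) (⊤ : MorphismProperty C) X Y

/-- The span `(f, g)`. -/
abbrev Spn.mk {X Y D : C} (f : D ⟶ X) (g : D ⟶ Y) : Spn X Y where
  apex := D
  l := f
  r := g
  wl := trivial
  wr := trivial

/-- `(f, g)° = (g, f)`. -/
abbrev Spn.conv {X Y : C} (S : Spn X Y) : Spn Y X := Spn.mk S.r S.l

/-- The meet of two spans `(f, g)` and `(p, q)`, i.e. the product in the slice over `X × Y`: it is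
`(π₁ d, π₂ d) = (f ρ₁, g ρ₁)`, where `d = ⟨f, g⟩ ρ₁ = ⟨p, q⟩ ρ₂` is the diagonal of the pullback
of `⟨f, g⟩` and `⟨p, q⟩`, with projections `ρ₁`, `ρ₂`. -/
noncomputable abbrev Spn.meet [HasPullbacks C] [HasBinaryProducts C] {X Y : C}
    (S T : Spn X Y) : Spn X Y :=
  Spn.mk (pullback.fst (prod.lift S.l S.r) (prod.lift T.l T.r) ≫ S.l)
    (pullback.fst (prod.lift S.l S.r) (prod.lift T.l T.r) ≫ S.r)

/-- `S ≤_E T`: there is a morphism of spans `S ⟶ T` which lies in `E`. -/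
def Spn.le (E : MorphismProperty C) {X Y : C} (S T : Spn X Y) : Prop :=
  ∃ x : S ⟶ T, E x.hom

/-- `∼_E`, the least equivalence relation containing `≤_E`. If `E` contains the isomorphisms, it
relates any two isomorphic spans. -/
def Spn.setoid (E : MorphismProperty C) (X Y : C) : Setoid (Spn X Y) :=
  Relation.EqvGen.setoid (Spn.le E)

theorem Spn.map_eqvGen {α β : Type*} {r : α → α → Prop} {r' : β → β → Prop} (F : α → β)
    (h : ∀ a b, r a b → r' (F a) (F b)) {a b : α} (hab : Relation.EqvGen r a b) :
    Relation.EqvGen r' (F a) (F b) := by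
  induction hab with
  | rel a b hab => exact .rel _ _ (h a b hab)
  | refl a => exact .refl _
  | symm a b _ ih => exact .symm _ _ ih
  | trans a b c _ _ ih₁ ih₂ => exact .trans _ _ _ ih₁ ih₂

theorem Spn.le_refl (E : MorphismProperty C) [E.ContainsIdentities] {X Y : C} (S : Spn X Y) :
    Spn.le E S S := ⟨𝟙 S, E.id_mem _⟩

/-- The category `Span_E(C)` for a stable system `E`: its objects are those of `C`. -/
structure SpanCat (E : MorphismProperty C) where
  /-- the underlying object of `C` -/
  obj : C

namespace SpanCat

variable {E : MorphismProperty C}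

/-- Morphisms of `Span_E(C)`: the `∼_E`-classes of spans. -/
def Hom (E : MorphismProperty C) (X Y : C) : Type (max u v) := Quotient (Spn.setoid E X Y)

variable [IsStableSystem E]

theorem eqv_of_iso {X Y : C} {S T : Spn X Y} (i : S.apex ≅ T.apex)
    (hl : i.hom ≫ T.l = S.l) (hr : i.hom ≫ T.r = S.r) : Spn.setoid E X Y S T :=
  .rel _ _ ⟨{ hom := i.hom, hom_l := hl, hom_r := hr }, IsStableSystem.of_isIso E i.hom⟩

variable [HasPullbacks C]

theorem le_comp {X Y Z : C} {S S' : Spn X Y} {T T' : Spn Y Z}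
    (h : Spn.le E S S') (k : Spn.le E T T') : Spn.le E (S.comp T) (S'.comp T') := by
  obtain ⟨x, hx⟩ := h
  obtain ⟨y, hy⟩ := k
  refine ⟨{ hom := pullback.map S.r T.l S'.r T'.l x.hom y.hom (𝟙 Y) (by simp) (by simp)
            hom_l := (pullback.lift_fst_assoc _ _ _ _).trans ((Category.assoc _ _ _).trans (by simp; rfl))
            hom_r := (pullback.lift_snd_assoc _ _ _ _).trans
              ((Category.assoc _ _ _).trans (by simp; rfl)) }, ?_⟩
  exact E.pullbackMap hx hy (by simp) (by simp)

theorem eqv_comp {X Y Z : C} ⦃S S' : Spn X Y⦄ (h : Spn.setoid E X Y S S')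
    ⦃T T' : Spn Y Z⦄ (k : Spn.setoid E Y Z T T') :
    Spn.setoid E X Z (S.comp T) (S'.comp T') :=
  .trans _ _ _
    (Spn.map_eqvGen (fun S : Spn X Y => (S.comp T : Spn X Z))
      (fun _ _ h => le_comp h (Spn.le_refl E T)) h)
    (Spn.map_eqvGen (fun T : Spn Y Z => (S'.comp T : Spn X Z))
      (fun _ _ h => le_comp (Spn.le_refl E S') h) k)

/-- The category structure: composition is induced by the composition of spans through
pullbacks. -/
noncomputable instance : Category.{max u v} (SpanCat E) where
  Hom X Y := Hom E X.obj Y.obj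
  id X := Quotient.mk _ (Span.id X.obj)
  comp := Quotient.map₂ (fun S T => S.comp T) eqv_comp
  id_comp := by
    rintro ⟨X⟩ ⟨Y⟩ ⟨(S : Spn X Y)⟩
    have hc := pullback.condition (f := 𝟙 X) (g := S.l)
    exact Quotient.sound (eqv_of_iso (S := (Span.id X).comp S) (T := S)
      (@asIso _ _ (pullback (𝟙 X) S.l) S.apex (pullback.snd (𝟙 X) S.l) inferInstance)
      hc.symm rfl)
  comp_id := by
    rintro ⟨X⟩ ⟨Y⟩ ⟨(S : Spn X Y)⟩
    have hc := pullback.condition (f := S.r) (g := 𝟙 Y)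
    exact Quotient.sound (eqv_of_iso (S := S.comp (Span.id Y)) (T := S)
      (@asIso _ _ (pullback S.r (𝟙 Y)) S.apex (pullback.fst S.r (𝟙 Y)) inferInstance)
      rfl hc)
  assoc := by
    rintro ⟨X⟩ ⟨Y⟩ ⟨Z⟩ ⟨W⟩ ⟨S⟩ ⟨T⟩ ⟨U⟩
    refine Quotient.sound (eqv_of_iso (S := (S.comp T).comp U) (T := S.comp (T.comp U))
      (pullbackAssoc S.r T.l T.r U.l) ?_ ?_)
    · exact (pullbackAssoc_hom_fst_assoc S.r T.l T.r U.l S.l).trans rfl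
    · exact pullbackAssoc_hom_snd_snd_assoc S.r T.l T.r U.l U.r

/-- The class `[f, g]_E` of the span `(f, g)`. -/
def cls (E : MorphismProperty C) [IsStableSystem E] {X Y D : C} (f : D ⟶ X) (g : D ⟶ Y) :
    (⟨X⟩ : SpanCat E) ⟶ ⟨Y⟩ :=
  Quotient.mk (Spn.setoid E X Y) (Spn.mk f g)

/-- The involution `[f, g]° = [g, f]`. -/
def conv {X Y : SpanCat E} (r : X ⟶ Y) : Y ⟶ X :=
  Quotient.map (sa := Spn.setoid E X.obj Y.obj) (sb := Spn.setoid E Y.obj X.obj)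
    Spn.conv (fun _ _ h => Spn.map_eqvGen Spn.conv (by
      rintro S T ⟨x, hx⟩
      exact ⟨{ hom := x.hom, hom_l := x.hom_r, hom_r := x.hom_l }, hx⟩) h) r

variable [HasBinaryProducts C]

theorem le_meet {X Y : C} {S S' T T' : Spn X Y}
    (h : Spn.le E S S') (k : Spn.le E T T') : Spn.le E (S.meet T) (S'.meet T') := by
  obtain ⟨x, hx⟩ := h
  obtain ⟨y, hy⟩ := k
  have e₁ : prod.lift S.l S.r = x.hom ≫ prod.lift S'.l S'.r := by simp [prod.comp_lift]
  have e₂ : prod.lift T.l T.r = y.hom ≫ prod.lift T'.l T'.r := by simp [prod.comp_lift]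
  refine ⟨{ hom := pullback.map _ _ _ _ x.hom y.hom (𝟙 (X ⨯ Y)) (by simp) (by simp)
            hom_l := (pullback.lift_fst_assoc _ _ _ _).trans (by simp)
            hom_r := (pullback.lift_fst_assoc _ _ _ _).trans (by simp) }, ?_⟩
  exact E.pullbackMap hx hy e₁ e₂

theorem eqv_meet {X Y : C} ⦃S S' : Spn X Y⦄ (h : Spn.setoid E X Y S S')
    ⦃T T' : Spn X Y⦄ (k : Spn.setoid E X Y T T') :
    Spn.setoid E X Y (S.meet T) (S'.meet T') :=
  .trans _ _ _
    (Spn.map_eqvGen (fun S : Spn X Y => S.meet T)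
      (fun _ _ h => le_meet h (Spn.le_refl E T)) h)
    (Spn.map_eqvGen (fun T : Spn X Y => S'.meet T)
      (fun _ _ h => le_meet (Spn.le_refl E S') h) k)

/-- The meet `[f, g] ∧ [p, q] = [(f, g) ∧ (p, q)]`. -/
noncomputable def meet {X Y : SpanCat E} (r s : X ⟶ Y) : X ⟶ Y :=
  Quotient.map₂ (sa := Spn.setoid E X.obj Y.obj) (sb := Spn.setoid E X.obj Y.obj)
    (sc := Spn.setoid E X.obj Y.obj) Spn.meet eqv_meet r s

end SpanCat

end Spans

end SpanAllegory

open SpanAllegory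

namespace SpanAllegory

/-! ### Graphs and diagonals belonging to E• -/

section

variable {C : Type u} [Category.{v} C]

/-! Everything rests on `MeetAbsorbs`: an arbitrary morphism of spans S ⟶ T, not only one in E•,
should force [S] ∧ [T] = [S]. Since E ⊆ E•, factoring the pairing of the legs of T replaces T by a
span whose pairing m lies in M. Then S ⟶ S ∧ T is the graph, over the product of the two feet, of a
morphism into the domain of m. Such a graph is a conjugate of m, so it lies in E• and identifies the
two classes (`bullet_graph`, `meetAbsorbs_bullet`).

Absorption turns the order into existence of span morphisms between suitable representatives
(`exists_hom_of_meet_eq`), so every inequality, the modular law included, follows from universal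
properties of pullbacks (`allegory`). For tabulations, m need not be monic, but its diagonal is a
graph and hence in E•; so 1 is the class of the kernel pair of m, which receives the meet in
question (`tabulates_cls`). -/

/-- The graph `X ⟶ X ×_W Y` of `f : X ⟶ Y` over `W` is the conjugate of `m : Y ⟶ W` along `f`
and the identity. -/
theorem bullet_graph {E M : MorphismProperty C} {X Y W Q : C} {m : Y ⟶ W} (hm : M m)
    {f : X ⟶ Y} {n : X ⟶ W} (w : f ≫ m = n) {t : Q ⟶ X} {g : Q ⟶ Y} (h : IsPullback t g n m)
    {c : X ⟶ Q} (ht : c ≫ t = 𝟙 X) (hg : c ≫ g = f) : bullet E M c := by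
  subst w
  exact fun F _ _ hF => hF _ (MorphismProperty.le_pullbacks _ _
    ⟨X, Y, Y, W, f, 𝟙 Y, m, f, 𝟙 X, g, t, hm, IsPullback.of_vert_isIso ⟨by simp⟩,
      by simpa using h.flip, hg, ht⟩)

/-- The diagonal is the graph of the identity. It makes m behave as a monomorphism modulo E•. -/
theorem bullet_diagonal [HasPullbacks C] {E M : MorphismProperty C} {R W : C} {m : R ⟶ W} (hm : M m) :
    bullet E M (pullback.lift (𝟙 R) (𝟙 R) rfl : R ⟶ pullback m m) :=
  bullet_graph hm (Category.id_comp m) (IsPullback.of_hasPullback m m)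
    (pullback.lift_fst _ _ _) (pullback.lift_snd _ _ _)

theorem le_bullet (E M : MorphismProperty C) : E ≤ bullet E M :=
  (bullet_isLeast E M).1.2.1

/-! ### Classes of spans and their meets -/

namespace SpanCat

/-- The class of a span. -/
def of (F : MorphismProperty C) [IsStableSystem F] [HasPullbacks C] {X Y : C} (S : Spn X Y) :
    (⟨X⟩ : SpanCat F) ⟶ ⟨Y⟩ :=
  Quotient.mk (Spn.setoid F X Y) S

/-- Meets of classes absorb morphisms of spans. -/
def MeetAbsorbs (F : MorphismProperty C) [IsStableSystem F] [HasPullbacks C]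
    [HasBinaryProducts C] : Prop :=
  ∀ ⦃X Y : C⦄ ⦃S T : Spn X Y⦄, (S ⟶ T) → meet (of F S) (of F T) = of F S

section

variable {F : MorphismProperty C} [IsStableSystem F] [HasPullbacks C]

theorem of_surjective {X Y : SpanCat F} (r : X ⟶ Y) : ∃ S : Spn X.obj Y.obj, of F S = r :=
  Quotient.exists_rep r

theorem of_eq_of_hom {X Y : C} {S T : Spn X Y} (x : S.apex ⟶ T.apex) (hx : F x)
    (hl : x ≫ T.l = S.l) (hr : x ≫ T.r = S.r) : of F S = of F T :=
  Quotient.sound (.rel _ _ ⟨{ hom := x, hom_l := hl, hom_r := hr }, hx⟩)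

theorem of_eq_of_iso {X Y : C} {S T : Spn X Y} (i : S.apex ≅ T.apex)
    (hl : i.hom ≫ T.l = S.l) (hr : i.hom ≫ T.r = S.r) : of F S = of F T :=
  of_eq_of_hom i.hom (IsStableSystem.of_isIso F _) hl hr

theorem conv_cls_comp_cls {X Y D : C} (f : D ⟶ X) (g : D ⟶ Y) :
    conv (cls F (𝟙 D) f) ≫ cls F (𝟙 D) g = cls F f g := by
  have hc := pullback.condition (f := 𝟙 D) (g := 𝟙 D)
  simp only [Category.comp_id] at hc
  exact of_eq_of_iso (S := (Spn.mk (𝟙 D) f).conv.comp (Spn.mk (𝟙 D) g)) (T := Spn.mk f g)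
    (@asIso _ _ (pullback (𝟙 D) (𝟙 D)) D (pullback.fst (𝟙 D) (𝟙 D)) inferInstance) rfl (congrArg (· ≫ g) hc)

variable [HasBinaryProducts C]

theorem meet_comm {X Y : SpanCat F} (r s : X ⟶ Y) : meet r s = meet s r := by
  obtain ⟨S, rfl⟩ := of_surjective r
  obtain ⟨T, rfl⟩ := of_surjective s
  have hc := pullback.condition (f := prod.lift S.l S.r) (g := prod.lift T.l T.r)
  refine of_eq_of_iso (S := S.meet T) (T := T.meet S) (pullbackSymmetry _ _) ?_ ?_
  · exact (pullbackSymmetry_hom_comp_fst_assoc _ _ _).trans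
      (by simpa [prod.lift_fst] using (congrArg (· ≫ prod.fst) hc).symm)
  · exact (pullbackSymmetry_hom_comp_fst_assoc _ _ _).trans
      (by simpa [prod.lift_snd] using (congrArg (· ≫ prod.snd) hc).symm)

/-- The projection of a meet of spans to its first component. -/
noncomputable def meetFst {X Y : C} (S T : Spn X Y) : S.meet T ⟶ S where
  hom := pullback.fst _ _
  hom_l := rfl
  hom_r := rfl

/-- The projection of a meet of spans to its second component. -/
noncomputable def meetSnd {X Y : C} (S T : Spn X Y) : S.meet T ⟶ T where
  hom := pullback.snd _ _
  hom_l := by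
    have hc := pullback.condition (f := prod.lift S.l S.r) (g := prod.lift T.l T.r)
    simpa [prod.lift_fst] using (congrArg (· ≫ prod.fst) hc).symm
  hom_r := by
    have hc := pullback.condition (f := prod.lift S.l S.r) (g := prod.lift T.l T.r)
    simpa [prod.lift_snd] using (congrArg (· ≫ prod.snd) hc).symm

/-- The universal property of the meet of spans. -/
noncomputable def meetLift {X Y : C} {R S T : Spn X Y} (x : R ⟶ S) (y : R ⟶ T) :
    R ⟶ S.meet T where
  hom := pullback.lift x.hom y.hom (by simp [prod.comp_lift])
  hom_l := (pullback.lift_fst_assoc _ _ _ _).trans x.hom_l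
  hom_r := (pullback.lift_fst_assoc _ _ _ _).trans x.hom_r

/-- A morphism into a composite of spans. -/
noncomputable def compLift {X Y Z : C} {R : Spn X Z} {S : Spn X Y} {T : Spn Y Z}
    (a : R.apex ⟶ S.apex) (b : R.apex ⟶ T.apex) (w : a ≫ S.r = b ≫ T.l)
    (hl : a ≫ S.l = R.l) (hr : b ≫ T.r = R.r) : R ⟶ S.comp T where
  hom := pullback.lift a b w
  hom_l := (pullback.lift_fst_assoc _ _ _ _).trans hl
  hom_r := (pullback.lift_snd_assoc _ _ _ _).trans hr

/-- The converse of absorption. The representative of the larger class stays as given and only the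
smaller one is changed, so chains of inequalities are unpacked from the top down. -/
theorem exists_hom_of_meet_eq {X Y : C} {r : (⟨X⟩ : SpanCat F) ⟶ ⟨Y⟩} {T : Spn X Y}
    (h : meet r (of F T) = r) : ∃ S : Spn X Y, of F S = r ∧ Nonempty (S ⟶ T) := by
  obtain ⟨S, rfl⟩ := of_surjective r
  exact ⟨S.meet T, h, ⟨meetSnd S T⟩⟩

/-! ### Order and allegory structure from absorption -/

/-- The order `r ≤ s ↔ r ∧ s = r`, with its binary infima. -/
noncomputable abbrev semilatticeInf (hF : MeetAbsorbs F) (X Y : SpanCat F) :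
    SemilatticeInf (X ⟶ Y) where
  le r s := meet r s = r
  inf := meet
  le_refl r := by
    obtain ⟨S, rfl⟩ := of_surjective r
    exact hF (𝟙 S)
  le_trans r s t hrs hst := by
    obtain ⟨U, rfl⟩ := of_surjective t
    obtain ⟨T, rfl, ⟨y⟩⟩ := exists_hom_of_meet_eq hst
    obtain ⟨S, rfl, ⟨x⟩⟩ := exists_hom_of_meet_eq hrs
    exact hF (x ≫ y)
  le_antisymm r s hrs hsr := hrs.symm.trans ((meet_comm r s).trans hsr)
  inf_le_left r s := by
    obtain ⟨S, rfl⟩ := of_surjective r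
    obtain ⟨T, rfl⟩ := of_surjective s
    exact hF (meetFst S T)
  inf_le_right r s := by
    obtain ⟨S, rfl⟩ := of_surjective r
    obtain ⟨T, rfl⟩ := of_surjective s
    exact hF (meetSnd S T)
  le_inf r s t hrs hrt := by
    obtain ⟨T, rfl⟩ := of_surjective s
    obtain ⟨U, rfl⟩ := of_surjective t
    obtain ⟨S, rfl, ⟨x⟩⟩ := exists_hom_of_meet_eq hrs
    obtain ⟨S', h, ⟨y⟩⟩ := exists_hom_of_meet_eq hrt
    -- The two bounds yield different representatives S and S' of the same class. Their meet
    -- represents it too, by idempotence, and projects to both.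
    have hS : of F (S.meet S') = of F S := by
      have := hF (𝟙 S)
      nth_rewrite 2 [← h] at this
      exact this
    rw [← hS]
    exact hF (meetLift (meetFst S S' ≫ x) (meetSnd S S' ≫ y))

/-- The allegory of spans modulo `F`, if meets absorb morphisms of spans. -/
noncomputable abbrev allegory (hF : MeetAbsorbs F) : Allegory (SpanCat F) where
  homInf := semilatticeInf hF
  comp_mono {X Y Z r r' s s'} hr hs := by
    obtain ⟨S', rfl⟩ := of_surjective r'
    obtain ⟨T', rfl⟩ := of_surjective s'
    obtain ⟨S, rfl, ⟨x⟩⟩ := exists_hom_of_meet_eq hr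
    obtain ⟨T, rfl, ⟨y⟩⟩ := exists_hom_of_meet_eq hs
    have hc := pullback.condition (f := S.r) (g := T.l)
    exact hF (compLift (R := S.comp T) (pullback.fst _ _ ≫ x.hom) (pullback.snd _ _ ≫ y.hom)
      (((Category.assoc _ _ _).trans (congrArg (pullback.fst S.r T.l ≫ ·) x.hom_r)).trans
        (hc.trans ((Category.assoc _ _ _).trans
          (congrArg (pullback.snd S.r T.l ≫ ·) y.hom_l)).symm))
      ((Category.assoc _ _ _).trans (congrArg (pullback.fst S.r T.l ≫ ·) x.hom_l))
      ((Category.assoc _ _ _).trans (congrArg (pullback.snd S.r T.l ≫ ·) y.hom_r)))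
  conv := conv
  conv_conv r := by
    obtain ⟨S, rfl⟩ := of_surjective r
    rfl
  conv_id X := rfl
  conv_comp {X Y Z} r s := by
    obtain ⟨S, rfl⟩ := of_surjective r
    obtain ⟨T, rfl⟩ := of_surjective s
    exact of_eq_of_iso (S := Spn.conv (S.comp T)) (T := T.conv.comp S.conv)
      (pullbackSymmetry S.r T.l)
      (pullbackSymmetry_hom_comp_fst_assoc _ _ _) (pullbackSymmetry_hom_comp_snd_assoc _ _ _)
  conv_inf {X Y} r s := by
    obtain ⟨S, rfl⟩ := of_surjective r
    obtain ⟨T, rfl⟩ := of_surjective s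
    let := semilatticeInf hF Y X
    let x := meetFst S T
    let y := meetSnd S T
    let x' := meetFst S.conv T.conv
    let y' := meetSnd S.conv T.conv
    apply le_antisymm
    · exact hF (S := Spn.conv (S.meet T)) (T := S.conv.meet T.conv)
        (meetLift ⟨x.hom, x.hom_r, x.hom_l⟩ ⟨y.hom, y.hom_r, y.hom_l⟩)
    · let z : Spn.conv (S.conv.meet T.conv) ⟶ S.meet T :=
        meetLift ⟨x'.hom, x'.hom_r, x'.hom_l⟩ ⟨y'.hom, y'.hom_r, y'.hom_l⟩
      exact hF (S := S.conv.meet T.conv) (T := Spn.conv (S.meet T)) ⟨z.hom, z.hom_r, z.hom_l⟩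
  modular {X Y Z} r s t := by
    obtain ⟨S, rfl⟩ := of_surjective r
    obtain ⟨T, rfl⟩ := of_surjective s
    obtain ⟨U, rfl⟩ := of_surjective t
    have hc := pullback.condition (f := S.r) (g := T.l)
    let p : Spn.meet (S.comp T) U ⟶ S.comp T := meetFst _ _
    let q : Spn.meet (S.comp T) U ⟶ U := meetSnd _ _
    let a := p.hom ≫ pullback.fst S.r T.l
    let b := p.hom ≫ pullback.snd S.r T.l
    have hal : a ≫ S.l = (Spn.meet (S.comp T) U).l :=
      (Category.assoc _ _ _).trans p.hom_l
    have hbr : b ≫ T.r = (Spn.meet (S.comp T) U).r :=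
      (Category.assoc _ _ _).trans p.hom_r
    have hab : a ≫ S.r = b ≫ T.l := (Category.assoc _ _ _).trans
      ((congrArg (p.hom ≫ ·) hc).trans (Category.assoc _ _ _).symm)
    -- A point of the left side is a pair (a, b) composable through Y together with a point q of U.
    -- V keeps its left foot but ends at the middle point in Y; it maps to S by a and to U followed
    -- by T° by (q, b). Composing with b again recovers the left side.
    let V : Spn X.obj Y.obj := Spn.mk ((Spn.meet (S.comp T) U).l) (a ≫ S.r)
    let c : V ⟶ S := ⟨a, hal, rfl⟩
    let d : V ⟶ U.comp T.conv :=
      compLift (R := V) q.hom b (q.hom_r.trans hbr.symm) q.hom_l hab.symm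
    let z : V ⟶ S.meet (U.comp T.conv) := meetLift c d
    exact hF (S := Spn.meet (S.comp T) U) (T := (S.meet (U.comp T.conv)).comp T)
      (compLift z.hom b (z.hom_r.trans hab) z.hom_l hbr)

/-! ### Maps, units and tabulations -/

/-- The class of `(1, f)` is total. -/
theorem id_le_comp_conv (hF : MeetAbsorbs F) {X Y : C} (f : X ⟶ Y) :
    letI := allegory hF
    𝟙 (⟨X⟩ : SpanCat F) ≤ cls F (𝟙 X) f ≫ Allegory.conv (cls F (𝟙 X) f) :=
  hF (S := Span.id X) (T := (Spn.mk (𝟙 X) f).comp (Spn.mk (𝟙 X) f).conv)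
    (compLift (𝟙 X) (𝟙 X) rfl (Category.id_comp _) (Category.id_comp _))

theorem isMap_cls_id (hF : MeetAbsorbs F) {X Y : C} (f : X ⟶ Y) :
    letI := allegory hF
    Allegory.IsMap (cls F (𝟙 X) f) := by
  refine ⟨id_le_comp_conv hF f, ?_⟩
  have hc := pullback.condition (f := 𝟙 X) (g := 𝟙 X)
  refine hF (S := (Spn.mk (𝟙 X) f).conv.comp (Spn.mk (𝟙 X) f)) (T := Span.id Y)
    ⟨pullback.fst (𝟙 X) (𝟙 X) ≫ f, Category.comp_id _, (Category.comp_id _).trans ?_⟩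
  simp only [Category.comp_id] at hc
  exact congrArg (· ≫ f) hc

theorem isUnitObject_of_isTerminal (hF : MeetAbsorbs F) {T : C} (hT : IsTerminal T) :
    letI := allegory hF
    Allegory.IsUnitObject (⟨T⟩ : SpanCat F) := by
  refine ⟨fun r => ?_, fun X => ⟨_, id_le_comp_conv hF (hT.from X.obj)⟩⟩
  obtain ⟨S, rfl⟩ := of_surjective r
  exact hF (T := Span.id T) ⟨S.l, hT.hom_ext _ _, hT.hom_ext _ _⟩

/-- Only one half needs the diagonal: totality of both maps already gives 1 below the meet, and the
reverse inequality goes through the kernel pair of m. -/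
theorem tabulates_cls (hF : MeetAbsorbs F) {X Y R : C} (m : R ⟶ X ⨯ Y)
    (hm : F (pullback.lift (𝟙 R) (𝟙 R) rfl : R ⟶ pullback m m)) :
    letI := allegory hF
    Allegory.Tabulates (cls F (𝟙 R) (m ≫ prod.fst)) (cls F (𝟙 R) (m ≫ prod.snd))
      (cls F (m ≫ prod.fst) (m ≫ prod.snd)) := by
  let := allegory hF
  refine ⟨isMap_cls_id hF _, isMap_cls_id hF _, (conv_cls_comp_cls _ _).symm,
    le_antisymm ?_ (le_inf (id_le_comp_conv hF _) (id_le_comp_conv hF _))⟩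
  -- The diagonal is a morphism in F from the identity span to the kernel pair.
  have hK : 𝟙 (⟨R⟩ : SpanCat F) = of F (Spn.mk (pullback.fst m m) (pullback.snd m m)) :=
    of_eq_of_hom (S := Span.id R) _ hm (pullback.lift_fst _ _ _) (pullback.lift_snd _ _ _)
  rw [hK]
  let S : Spn R X := Spn.mk (𝟙 R) (m ≫ prod.fst)
  let T : Spn R Y := Spn.mk (𝟙 R) (m ≫ prod.snd)
  let L : Spn R R := Spn.meet (S.comp S.conv) (T.comp T.conv)
  have kernel {Z : C} (n : R ⟶ Z) :
      ((Spn.mk (𝟙 R) n).comp (Spn.mk (𝟙 R) n).conv).l ≫ n =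
        ((Spn.mk (𝟙 R) n).comp (Spn.mk (𝟙 R) n).conv).r ≫ n := by
    have hc := pullback.condition (f := n) (g := n)
    exact (congrArg (· ≫ n) (Category.comp_id _)).trans
      (hc.trans (congrArg (· ≫ n) (Category.comp_id _)).symm)
  have equalize {Z : C} {n : R ⟶ Z} {K : Spn R R} (p : L ⟶ K) (h : K.l ≫ n = K.r ≫ n) :
      L.l ≫ n = L.r ≫ n := by
    rw [← Span.Hom.hom_l p, ← Span.Hom.hom_r p, Category.assoc, Category.assoc, h]
  -- Projecting L to either composite shows that its legs agree after one component of m; together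
  -- the two components give m.
  have h : L.l ≫ m = L.r ≫ m := by
    apply Limits.prod.hom_ext
    · exact (Category.assoc L.l m _).trans
        ((equalize (meetFst _ _) (kernel _)).trans (Category.assoc L.r m _).symm)
    · exact (Category.assoc L.l m _).trans
        ((equalize (meetSnd _ _) (kernel _)).trans (Category.assoc L.r m _).symm)
  exact hF (S := L) ⟨pullback.lift L.l L.r h, pullback.lift_fst _ _ _, pullback.lift_snd _ _ _⟩

end

/-! ### Absorption for E• -/

section

variable [HasPullbacks C] [HasBinaryProducts C] {E M : MorphismProperty C}

theorem cls_eq_of_factorization {X Y D R : C} {f : D ⟶ X} {g : D ⟶ Y} {e : D ⟶ R}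
    {m : R ⟶ X ⨯ Y} (he : E e) (h : e ≫ m = prod.lift f g) :
    cls (bullet E M) f g = cls (bullet E M) (m ≫ prod.fst) (m ≫ prod.snd) :=
  of_eq_of_hom (S := Spn.mk f g) (T := Spn.mk (m ≫ prod.fst) (m ≫ prod.snd)) e
    (le_bullet E M _ he) (by simp [reassoc_of% h, prod.lift_fst]) (by simp [reassoc_of% h, prod.lift_snd])

/-- T may be any span; passing to the M-part of its factorization keeps its class and makes the
comparison S ⟶ S ∧ T a graph. -/
theorem meetAbsorbs_bullet (h : MorphismProperty.HasFactorization E M) :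
    MeetAbsorbs (bullet E M) := by
  intro X Y S T x
  obtain ⟨⟨R, e, m, hem, he, hm⟩⟩ := h.nonempty_mapFactorizationData (prod.lift T.l T.r)
  have hT : of (bullet E M) T = of (bullet E M) (Spn.mk (m ≫ prod.fst) (m ≫ prod.snd)) :=
    cls_eq_of_factorization he hem
  rw [hT]
  have hm' : prod.lift (m ≫ prod.fst) (m ≫ prod.snd) = m := by
    apply Limits.prod.hom_ext
    · exact prod.lift_fst _ _
    · exact prod.lift_snd _ _
  have w : (x.hom ≫ e) ≫ m = prod.lift S.l S.r := by simp [hem, prod.comp_lift]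
  refine (of_eq_of_hom (S := S) (T := S.meet (Spn.mk (m ≫ prod.fst) (m ≫ prod.snd)))
    (pullback.lift (𝟙 _) (x.hom ≫ e) (by rw [hm', w, Category.id_comp])) ?_
    ((pullback.lift_fst_assoc _ _ _ _).trans (Category.id_comp _))
    ((pullback.lift_fst_assoc _ _ _ _).trans (Category.id_comp _))).symm
  -- The comparison is the graph of `x.hom ≫ e` over X ⨯ Y. The rewrites by `hm'` are needed because
  -- meets of spans are formed from the pairing of the legs rather than from m itself.
  exact bullet_graph (m := prod.lift (m ≫ prod.fst) (m ≫ prod.snd)) (by rwa [hm'])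
    (by rw [hm', w]) (IsPullback.of_hasPullback _ _) (pullback.lift_fst _ _ _)
    (pullback.lift_snd _ _ _)

end

end SpanCat

end

end SpanAllegory

/-! ### The theorem -/

open SpanAllegory
theorem mainTheorem2 {C : Type u} [Category.{v} C] [HasFiniteLimits C]
    (E M : MorphismProperty C) (hEM : IsStableFactorizationSystem E M) :
    ∃ 𝒜 : Allegory (SpanCat (bullet E M)),
      -- the involution and the meets (hence the order) are those induced by spans
      (∀ (A B : SpanCat (bullet E M)) (r : A ⟶ B),
        𝒜.conv r = SpanCat.conv r) ∧
      (∀ (A B : SpanCat (bullet E M)) (r s : A ⟶ B),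
        r ⊓ s = SpanCat.meet r s) ∧
      -- unitary and tabular
      Allegory.IsUnitary (SpanCat (bullet E M)) ∧
      Allegory.IsTabular (SpanCat (bullet E M)) ∧
      -- a terminal object of `C` is a unit
      (∀ T : C, IsTerminal T →
        Allegory.IsUnitObject
          (⟨T⟩ : SpanCat (bullet E M))) ∧
      -- the tabulation of `[f, g]`, for any factorization of `⟨f, g⟩` as `e` followed by `m`
      (∀ {A B D R : C} (f : D ⟶ A) (g : D ⟶ B) (e : D ⟶ R) (m : R ⟶ A ⨯ B),
        E e → M m → e ≫ m = prod.lift f g →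
        Allegory.Tabulates
          (SpanCat.cls (bullet E M) (𝟙 R) (m ≫ prod.fst))
          (SpanCat.cls (bullet E M) (𝟙 R) (m ≫ prod.snd))
          (SpanCat.cls (bullet E M) f g)) := by
  have hF := SpanCat.meetAbsorbs_bullet hEM.hasFactorization
  let 𝒜 := SpanCat.allegory hF
  have tab : ∀ {A B D R : C} (f : D ⟶ A) (g : D ⟶ B) (e : D ⟶ R) (m : R ⟶ A ⨯ B),
      E e → M m → e ≫ m = prod.lift f g →
      Allegory.Tabulates
        (SpanCat.cls (bullet E M) (𝟙 R) (m ≫ prod.fst))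
        (SpanCat.cls (bullet E M) (𝟙 R) (m ≫ prod.snd))
        (SpanCat.cls (bullet E M) f g) := by
    intro A B D R f g e m he hm h
    rw [SpanCat.cls_eq_of_factorization he h]
    exact SpanCat.tabulates_cls hF m (bullet_diagonal hm)
  refine ⟨𝒜, fun _ _ _ => rfl, fun _ _ _ _ => rfl,
    ⟨⟨⊤_ C⟩, SpanCat.isUnitObject_of_isTerminal hF terminalIsTerminal⟩, ?_,
    fun T hT => SpanCat.isUnitObject_of_isTerminal hF hT, tab⟩
  intro X Y r
  obtain ⟨S, rfl⟩ := SpanCat.of_surjective r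
  obtain ⟨⟨R, e, m, hem, he, hm⟩⟩ :=
    hEM.hasFactorization.nonempty_mapFactorizationData (prod.lift S.l S.r)
  exact ⟨_, _, _, tab S.l S.r e m he hm hem⟩
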